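/- Let $d\ge 1$ and let $w=(w_1,\dots,w_r)$ satisfy $1>w_1>w_2>\dots>w_r>0$ and $\sum_i w_i=1$. The $r$-lineup polytope $L_r([-1,1]^d)$ (with respect to the weights $w$) is the convex hull of all points $\sum_{i=1}^r w_i v_i$, where $(v_1,\dots,v_r)$ runs over the ordered lists of $r$ distinct vertices of the cube $[-1,1]^d$. For $x\in\mathbb{R}^d$ let $x^{\downarrow}$ be the vector of the absolute values $|x_1|,\dots,|x_d|$ arranged in weakly decreasing order, and let $\Phi_d=\{y\in\mathbb{R}^d : y_1\ge y_2\ge\dots\ge y_d\ge 0\}$ be the fundamental chamber. **Proposition.** Let $r\ge 2$ and $N\ge r-1$, with $(r,N)\ne(2,1)$ and $(r,N)\neq(3,2)$, let $w$ be weights as above, and let $I\subseteq\Phi_N\times\mathbb{R}$ be a finite set such that $$L_r([-1,1]^N)=\{x\in\mathbb{R}^N : \langle y,x^{\downarrow}\rangle\le b\ \text{ for all }(y,b)\in I\}.$$ Then for every $M>N$ $$L_r([-1,1]^M)=\{x\in\mathbb{R}^M : \langle y',x^{\downarrow}\rangle\le b'\ \text{ for all }(y,b)\in I\},$$ where, for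 $(y,b)\in I$, the pair $(y',b')$ is obtained as follows: * if $y$ is not a multiple of $(1,0,\dots,0)$, then $y'=(y_1,\dots,y_1,y_1,y_2,\dots,y_N)\in\mathbb{R}^M$ is $y$ with $M-N$ copies of $y_1$ put in front, and $b'=b+(M-N)y_1$; * if $y=c\,(1,0,\dots,0)$ with $c\ge 0$, then $y'=c\,(1,0,\dots,0)\in\mathbb{R}^M$ and $b'=b$. In both cases $y'\in\Phi_M$. -/

import Mathlib

namespace LineupCube

/-- Weights of length `r`: strictly decreasing numbers in the open interval `(0, 1)` with
total sum `1`. -/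
structure IsWeight {r : ℕ} (w : Fin r → ℝ) : Prop where
  strictAnti : StrictAnti w
  pos : ∀ i, 0 < w i
  lt_one : ∀ i, w i < 1
  sum_eq_one : ∑ i, w i = 1

/-- The occupation vector of an ordered list `ℓ` of `r` points with respect to `w`. -/
def occupation {r d : ℕ} (w : Fin r → ℝ) (ℓ : Fin r → (Fin d → ℝ)) : Fin d → ℝ :=
  ∑ i, w i • ℓ i

/-- The `r`-lineup polytope of a point configuration `A`: the convex hull of the occupation
vectors of all ordered `r`-subsets of `A`. -/
def lineupPolytopeOfPoints {r d : ℕ} (w : Fin r → ℝ) (A : Set (Fin d → ℝ)) :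
    Set (Fin d → ℝ) :=
  convexHull ℝ
    {o | ∃ ℓ : Fin r → (Fin d → ℝ), Function.Injective ℓ ∧ (∀ i, ℓ i ∈ A) ∧ o = occupation w ℓ}

/-- The `r`-lineup polytope of a polytope `P`: that of the configuration of its vertices. -/
def lineupPolytope {r d : ℕ} (w : Fin r → ℝ) (P : Set (Fin d → ℝ)) : Set (Fin d → ℝ) :=
  lineupPolytopeOfPoints w (P.extremePoints ℝ)

/-- The cube `[-1, 1]^d`. -/
def cube (d : ℕ) : Set (Fin d → ℝ) :=
  {x | ∀ i, x i ∈ Set.Icc (-1 : ℝ) 1}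

/-- The fundamental chamber: weakly decreasing vectors with nonnegative entries. -/
def chamber (d : ℕ) : Set (Fin d → ℝ) :=
  {y | Antitone y ∧ ∀ i, 0 ≤ y i}

/-- `x^↓`: the absolute values of the entries of `x`, in weakly decreasing order. -/
noncomputable def absDown {d : ℕ} (x : Fin d → ℝ) : Fin d → ℝ :=
  fun i => |x (Tuple.sort (fun j => -|x j|) i)|

/-- `I` is an H-representation of `P` by inequalities `⟨y, x^↓⟩ ≤ b`, `(y, b) ∈ I`, with `y` in
the fundamental chamber (and, as always in an H-representation, finitely many of them). -/
def IsHRep {d : ℕ} (P : Set (Fin d → ℝ)) (I : Set ((Fin d → ℝ) × ℝ)) : Prop :=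
  I.Finite ∧ (∀ p ∈ I, p.1 ∈ chamber d) ∧ P = {x | ∀ p ∈ I, p.1 ⬝ᵥ absDown x ≤ p.2}

/-- `(y_1, …, y_1, y_1, …, y_N)` with `M - N` copies of `y_1` put in front of `y`. -/
def prependFirst {N : ℕ} (hN : 0 < N) (M : ℕ) (y : Fin N → ℝ) : Fin M → ℝ :=
  fun j =>
    if (j : ℕ) < M - N then y ⟨0, hN⟩
    else y ⟨(j : ℕ) - (M - N), by have := j.isLt; omega⟩

/-- `(y_1, 0, …, 0)` of length `M`. -/
def axisVector {N : ℕ} (hN : 0 < N) (M : ℕ) (y : Fin N → ℝ) : Fin M → ℝ :=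
  fun j => if (j : ℕ) = 0 then y ⟨0, hN⟩ else 0

open Classical in
/-- The lift of an inequality `(y, b)` from dimension `N` to dimension `M`. The exceptional case
is that of `y = c • (1, 0, …, 0)`, which goes to `c • (1, 0, …, 0)` with `b` unchanged. -/
noncomputable def liftIneq {N : ℕ} (hN : 0 < N) (M : ℕ) (p : (Fin N → ℝ) × ℝ) :
    (Fin M → ℝ) × ℝ :=
  if ∀ i : Fin N, (i : ℕ) ≠ 0 → p.1 i = 0 then (axisVector hN M p.1, p.2)
  else (prependFirst hN M p.1, p.2 + ((M : ℝ) - (N : ℝ)) * p.1 ⟨0, hN⟩)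

/-- The entries of `x^↓` are weakly decreasing. -/
theorem absDown_antitone {d : ℕ} (x : Fin d → ℝ) : Antitone (absDown x) := by
  intro i j hij
  have h := Tuple.monotone_sort (fun j => -|x j|) hij
  simpa [absDown] using h

end LineupCube

/-!
The lineup polytope is the convex hull of the points `setPoint w S = 1 - 2 ∑ w i • 1_{S i}`, where
`S` runs over the lists of `r` distinct sets of coordinates. For `z` in the chamber its support
function is therefore `∑ z j - 2 c(z)`, where `c(z)` is the least `cost w z S`. Since `r ≤ N + 1`,
any set using a coordinate outside the last `N` can be exchanged for the empty set or for a
singleton inside them, so `c(z)` depends on the last `N` coordinates only. This makes the lifted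
inequalities valid (`IsHRep.liftIneq_dotProduct_le`); the two excluded pairs `(r, N)` are those for
which a facet of the cube has fewer than `r` vertices, so that `x₁ ≤ 1` is not attained.

Conversely, let `x` in the chamber of `ℝ^(k+N)` satisfy the lifted inequalities. One of them is a
multiple of `x₁ ≤ 1` (`IsHRep.exists_axis`). Cutting off the first `k` coordinates and subtracting
their deficits `1 - x j` from the next one gives `x' ∈ ℝ^N` that satisfies the original
inequalities. It need not be sorted, so it need not lie in the small polytope, but it satisfies
every valid inequality with normal vector in the chamber (`IsHRep.exists_dotProduct_le`), and those
at `x'` imply those at `x`, the support functions differing by the sum of the first `k` entries of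
`z` (`IsHRep.mem_of_liftIneq`).

The heart is `IsHRep.exists_dotProduct_le_of_strict`. Let `z` be in the interior of the chamber,
and let `v` be the occupation vector of a `z`-optimal list. Exchange arguments show that `v` is
positive and strictly decreasing except for an initial block of ones. If `x'` violated the
inequality of `z`, the segment from `(1 - ε) v` to `(1 - ε) v + ε x'` would leave the polytope at a
point `s` close to `v`, where some given inequality `(y, b)`, also attained at `v`, is attained by a
signed permutation of `s`. If `y` is not constant on the block of ones of `v`, its face lies in a
facet of the cube (`IsOptimal.dotProduct_lt`), whereas the coordinates of `s` are less than `1` in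
absolute value. If it is constant there, then `y` and `s` are similarly sorted, so `⟨y, s⟩ ≥ b`,
contradicting `⟨y, x'⟩ ≤ b`, since `s` is a combination of `v` and `x'` with total weight below `1`
and `b > 0`.
-/

namespace LineupCube

open Filter Topology

/-! ### Vertices of the cube and occupation vectors -/

/-- The vertex of the cube whose negative coordinates are those in `S`. -/
def signVec {d : ℕ} (S : Finset (Fin d)) : Fin d → ℝ := fun j => if j ∈ S then -1 else 1

theorem signVec_eq_or {d : ℕ} (S : Finset (Fin d)) (j : Fin d) :
    signVec S j = 1 ∨ signVec S j = -1 := by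
  unfold signVec; split_ifs <;> simp

theorem signVec_ne_zero {d : ℕ} (S : Finset (Fin d)) (j : Fin d) : signVec S j ≠ 0 := by
  rcases signVec_eq_or S j with h | h <;> simp [h]

theorem abs_signVec {d : ℕ} (S : Finset (Fin d)) (j : Fin d) : |signVec S j| = 1 := by
  rcases signVec_eq_or S j with h | h <;> simp [h]

theorem signVec_injective {d : ℕ} : Function.Injective (signVec (d := d)) := by
  intro S T h
  ext j
  have := congrFun h j
  unfold signVec at this
  split_ifs at this with h1 h2 h2 <;> first | tauto | norm_num at this

theorem exists_signVec_eq {d : ℕ} {v : Fin d → ℝ} (hv : ∀ j, v j = 1 ∨ v j = -1) :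
    ∃ S, v = signVec S := by
  classical
  refine ⟨Finset.univ.filter (fun j => v j = -1), ?_⟩
  ext j
  rcases hv j with h | h <;> simp [signVec, h]

theorem mem_extremePoints_cube {d : ℕ} (v : Fin d → ℝ) :
    v ∈ (cube d).extremePoints ℝ ↔ ∀ j, v j = 1 ∨ v j = -1 := by
  have h : cube d = Set.univ.pi (fun _ : Fin d => Set.Icc (-1 : ℝ) 1) := by
    ext x; simp [cube, Pi.le_def, forall_and]
  rw [h, extremePoints_pi]
  simp only [Set.extremePoints_Icc (by norm_num : (-1 : ℝ) ≤ 1), Set.mem_univ_pi,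
    Set.mem_insert_iff, Set.mem_singleton_iff]
  exact forall_congr' fun j => or_comm

/-- The occupation vector of the list of vertices of the cube with negative coordinate sets
`S 0, S 1, …`. -/
def setPoint {r d : ℕ} (w : Fin r → ℝ) (S : Fin r → Finset (Fin d)) : Fin d → ℝ :=
  occupation w (fun i => signVec (S i))

/-- The weighted total `z`-mass of the sets of the list `S`. -/
def cost {r d : ℕ} (w : Fin r → ℝ) (z : Fin d → ℝ) (S : Fin r → Finset (Fin d)) : ℝ :=
  ∑ i, w i * ∑ j ∈ S i, z j

theorem setPoint_apply {r d : ℕ} {w : Fin r → ℝ} (hw : IsWeight w)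
    (S : Fin r → Finset (Fin d)) (j : Fin d) :
    setPoint w S j = 1 - 2 * ∑ i, if j ∈ S i then w i else 0 := by
  have h : ∀ i, w i * signVec (S i) j = w i - 2 * (if j ∈ S i then w i else 0) := by
    intro i; unfold signVec; split_ifs <;> ring
  simp only [setPoint, occupation, Finset.sum_apply, Pi.smul_apply, smul_eq_mul, h,
    Finset.sum_sub_distrib, hw.sum_eq_one, Finset.mul_sum]

theorem dotProduct_setPoint {r d : ℕ} {w : Fin r → ℝ} (hw : IsWeight w) (z : Fin d → ℝ)
    (S : Fin r → Finset (Fin d)) :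
    z ⬝ᵥ setPoint w S = ∑ j, z j - 2 * cost w z S := by
  have h : cost w z S = ∑ j, z j * ∑ i, if j ∈ S i then w i else 0 := by
    simp only [cost, Finset.mul_sum]
    rw [Finset.sum_comm' (t' := Finset.univ) (s' := fun j => Finset.univ.filter (j ∈ S ·))
      (by simp)]
    refine Finset.sum_congr rfl fun j _ => ?_
    rw [Finset.sum_filter]
    exact Finset.sum_congr rfl fun i _ => by split_ifs <;> ring
  simp only [dotProduct, setPoint_apply hw, h, Finset.mul_sum, ← Finset.sum_sub_distrib]
  refine Finset.sum_congr rfl fun j _ => ?_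
  rw [mul_sub, mul_one, Finset.mul_sum]
  congr 1
  exact Finset.sum_congr rfl fun i _ => by ring

theorem setPoint_le_one {r d : ℕ} {w : Fin r → ℝ} (hw : IsWeight w)
    (S : Fin r → Finset (Fin d)) (j : Fin d) : setPoint w S j ≤ 1 := by
  rw [setPoint_apply hw]
  have : 0 ≤ ∑ i, if j ∈ S i then w i else 0 :=
    Finset.sum_nonneg fun i _ => by split_ifs <;> [exact (hw.pos i).le; rfl]
  linarith

theorem lineupPolytope_cube {r d : ℕ} (w : Fin r → ℝ) :
    lineupPolytope w (cube d) =
      convexHull ℝ (setPoint w '' {S : Fin r → Finset (Fin d) | Function.Injective S}) := by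
  unfold lineupPolytope lineupPolytopeOfPoints
  congr 1
  ext o
  simp only [mem_extremePoints_cube, Set.mem_ofPred_eq, Set.mem_image]
  constructor
  · rintro ⟨ℓ, hi, hv, rfl⟩
    choose S hS using fun i => exists_signVec_eq (hv i)
    refine ⟨S, fun a b hab => hi ?_, ?_⟩
    · rw [hS, hS, hab]
    · unfold setPoint; congr 1; ext1 i; exact (hS i).symm
  · rintro ⟨S, hS, rfl⟩
    exact ⟨_, signVec_injective.comp hS, fun i => signVec_eq_or _, rfl⟩

theorem setPoint_mem {r d : ℕ} (w : Fin r → ℝ) {S : Fin r → Finset (Fin d)}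
    (hS : Function.Injective S) : setPoint w S ∈ lineupPolytope w (cube d) := by
  rw [lineupPolytope_cube]
  exact subset_convexHull ℝ _ ⟨S, hS, rfl⟩

theorem convex_lineupPolytope {r d : ℕ} (w : Fin r → ℝ) (A : Set (Fin d → ℝ)) :
    Convex ℝ (lineupPolytope w A) := convex_convexHull ℝ _

theorem isClosed_lineupPolytope_cube {r d : ℕ} (w : Fin r → ℝ) :
    IsClosed (lineupPolytope w (cube d)) := by
  rw [lineupPolytope_cube]
  exact Set.Finite.isClosed_convexHull ℝ (Set.Finite.image _ (Set.toFinite _))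

/-- A linear functional is bounded on the lineup polytope by its bound on the generators. -/
theorem dotProduct_le_of_mem {r d : ℕ} {w : Fin r → ℝ} {z : Fin d → ℝ} {c : ℝ}
    (h : ∀ S : Fin r → Finset (Fin d), Function.Injective S → z ⬝ᵥ setPoint w S ≤ c)
    {p : Fin d → ℝ} (hp : p ∈ lineupPolytope w (cube d)) : z ⬝ᵥ p ≤ c := by
  rw [lineupPolytope_cube] at hp
  have hc : Convex ℝ {p : Fin d → ℝ | z ⬝ᵥ p ≤ c} :=
    convex_halfSpace_le (𝕜 := ℝ) (f := fun p => z ⬝ᵥ p)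
      ⟨fun x y => dotProduct_add _ _ _, fun a x => dotProduct_smul _ _ _⟩ c
  exact convexHull_min (by rintro _ ⟨S, hS, rfl⟩; exact h S hS) hc hp

/-! ### Signed permutations and the fundamental chamber -/

/-- The signed permutation of coordinates given by the permutation `σ` and by the set `A` of
coordinates that change sign. -/
def signedPerm {d : ℕ} (σ : Equiv.Perm (Fin d)) (A : Finset (Fin d)) :
    (Fin d → ℝ) →ₗ[ℝ] (Fin d → ℝ) where
  toFun x := fun i => signVec A i * x (σ i)
  map_add' x y := by ext i; simp [mul_add]
  map_smul' c x := by ext i; simp; ring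

theorem signedPerm_apply {d : ℕ} (σ : Equiv.Perm (Fin d)) (A : Finset (Fin d))
    (x : Fin d → ℝ) (i : Fin d) : signedPerm σ A x i = signVec A i * x (σ i) := rfl

theorem signedPerm_mem {r d : ℕ} (w : Fin r → ℝ) (σ : Equiv.Perm (Fin d))
    (A : Finset (Fin d)) {x : Fin d → ℝ} (hx : x ∈ lineupPolytope w (cube d)) :
    signedPerm σ A x ∈ lineupPolytope w (cube d) := by
  have h := Set.mem_image_of_mem (signedPerm σ A) hx
  unfold lineupPolytope lineupPolytopeOfPoints at h
  rw [LinearMap.image_convexHull] at h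
  refine convexHull_mono ?_ h
  rintro _ ⟨o, ⟨ℓ, hi, hv, rfl⟩, rfl⟩
  refine ⟨fun i => signedPerm σ A (ℓ i), fun a b hab => hi ?_, fun i => ?_, ?_⟩
  · ext j
    have := congrFun hab (σ.symm j)
    simpa [signedPerm_apply, signVec_ne_zero] using this
  · have := (mem_extremePoints_cube _).1 (hv i)
    rw [mem_extremePoints_cube]
    intro j
    simp only [signedPerm_apply]
    rcases signVec_eq_or A j with h1 | h1 <;> rcases this (σ j) with h2 | h2 <;> simp [h1, h2]
  · simp [occupation]

theorem absDown_eq_signedPerm {d : ℕ} (x : Fin d → ℝ) :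
    ∃ σ A, absDown x = signedPerm σ A x := by
  classical
  refine ⟨Tuple.sort (fun j => -|x j|),
    Finset.univ.filter (fun i => x (Tuple.sort (fun j => -|x j|) i) < 0), ?_⟩
  ext i
  simp only [absDown, signedPerm_apply, signVec, Finset.mem_filter, Finset.mem_univ, true_and]
  split_ifs with h
  · rw [abs_of_neg h]; ring
  · rw [abs_of_nonneg (not_lt.1 h), one_mul]

theorem eq_signedPerm_absDown {d : ℕ} (x : Fin d → ℝ) :
    ∃ σ A, x = signedPerm σ A (absDown x) := by
  classical
  refine ⟨(Tuple.sort (fun j => -|x j|)).symm, Finset.univ.filter (fun i => x i < 0), ?_⟩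
  ext i
  simp only [absDown, signedPerm_apply, signVec, Finset.mem_filter, Finset.mem_univ, true_and,
    Equiv.apply_symm_apply]
  split_ifs with h
  · rw [abs_of_neg h]; ring
  · rw [abs_of_nonneg (not_lt.1 h), one_mul]

theorem absDown_mem_chamber {d : ℕ} (x : Fin d → ℝ) : absDown x ∈ chamber d :=
  ⟨absDown_antitone x, fun _ => abs_nonneg _⟩

theorem absDown_mem_lineupPolytope_iff {r d : ℕ} (w : Fin r → ℝ) (x : Fin d → ℝ) :
    absDown x ∈ lineupPolytope w (cube d) ↔ x ∈ lineupPolytope w (cube d) := by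
  constructor <;> intro h
  · obtain ⟨σ, A, e⟩ := eq_signedPerm_absDown x
    rw [e]; exact signedPerm_mem w σ A h
  · obtain ⟨σ, A, e⟩ := absDown_eq_signedPerm x
    rw [e]; exact signedPerm_mem w σ A h

/-- The rearrangement inequality for signed permutations of a nonnegative vector. -/
theorem dotProduct_signedPerm_le {d : ℕ} {y x : Fin d → ℝ} (hy : ∀ i, 0 ≤ y i)
    (hx : ∀ i, 0 ≤ x i) (hyx : Monovary y x) (σ : Equiv.Perm (Fin d)) (A : Finset (Fin d)) :
    y ⬝ᵥ signedPerm σ A x ≤ y ⬝ᵥ x := by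
  refine le_trans (Finset.sum_le_sum fun i _ => ?_) (hyx.sum_mul_comp_perm_le_sum_mul (σ := σ))
  refine mul_le_mul_of_nonneg_left ?_ (hy i)
  rw [signedPerm_apply]
  have := hx (σ i)
  rcases signVec_eq_or A i with h | h <;> rw [h] <;> linarith

theorem monovary_of_mem_chamber {d : ℕ} {y x : Fin d → ℝ} (hy : y ∈ chamber d)
    (hx : x ∈ chamber d) : Monovary y x := hy.1.monovary hx.1

theorem dotProduct_signedPerm_le_absDown {d : ℕ} {y : Fin d → ℝ} (hy : y ∈ chamber d)
    (x : Fin d → ℝ) (σ : Equiv.Perm (Fin d)) (A : Finset (Fin d)) :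
    y ⬝ᵥ signedPerm σ A x ≤ y ⬝ᵥ absDown x := by
  have hmono : Monovary y (absDown x) := monovary_of_mem_chamber hy (absDown_mem_chamber x)
  refine le_trans (Finset.sum_le_sum fun i _ => mul_le_mul_of_nonneg_left
    (c := absDown x ((σ.trans (Tuple.sort (fun j => -|x j|)).symm) i)) ?_ (hy.2 i))
    (hmono.sum_mul_comp_perm_le_sum_mul (σ := σ.trans (Tuple.sort (fun j => -|x j|)).symm))
  rw [signedPerm_apply]
  calc _ ≤ |signVec A i * x (σ i)| := le_abs_self _
    _ = _ := by simp [abs_mul, abs_signVec, absDown]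

theorem IsHRep.mem_iff {r d : ℕ} {w : Fin r → ℝ} {I : Set ((Fin d → ℝ) × ℝ)}
    (hI : IsHRep (lineupPolytope w (cube d)) I) (x : Fin d → ℝ) :
    x ∈ lineupPolytope w (cube d) ↔ ∀ p ∈ I, ∀ σ A, p.1 ⬝ᵥ signedPerm σ A x ≤ p.2 := by
  rw [hI.2.2, Set.mem_ofPred_eq]
  refine forall₂_congr fun p hp => ⟨fun h σ A => ?_, fun h => ?_⟩
  · exact (dotProduct_signedPerm_le_absDown (hI.2.1 p hp) x σ A).trans h
  · obtain ⟨σ, A, e⟩ := absDown_eq_signedPerm x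
    rw [e]; exact h σ A

theorem IsHRep.dotProduct_le {r d : ℕ} {w : Fin r → ℝ} {I : Set ((Fin d → ℝ) × ℝ)}
    (hI : IsHRep (lineupPolytope w (cube d)) I) {p : (Fin d → ℝ) × ℝ} (hp : p ∈ I)
    {x : Fin d → ℝ} (hx : x ∈ lineupPolytope w (cube d)) : p.1 ⬝ᵥ x ≤ p.2 := by
  have := (hI.mem_iff x).1 hx p hp (Equiv.refl _) ∅
  convert this using 2
  ext i; simp [signedPerm_apply, signVec]

/-- A vector of the chamber outside the lineup polytope is separated from it by a vector of the
chamber. -/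
theorem exists_chamber_separating {r d : ℕ} (w : Fin r → ℝ) {x : Fin d → ℝ}
    (hxc : x ∈ chamber d) (hx : x ∉ lineupPolytope w (cube d)) :
    ∃ z ∈ chamber d, ∀ S : Fin r → Finset (Fin d), Function.Injective S →
      z ⬝ᵥ setPoint w S < z ⬝ᵥ x := by
  obtain ⟨f, u, hf, hu⟩ := geometric_hahn_banach_closed_point (convex_lineupPolytope w (cube d))
    (isClosed_lineupPolytope_cube w) hx
  obtain ⟨y, hy⟩ : ∃ y : Fin d → ℝ, ∀ p, f p = y ⬝ᵥ p := by
    refine ⟨fun i => f (Pi.single i 1), fun p => ?_⟩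
    conv_lhs => rw [pi_eq_sum_univ' p]
    simp [dotProduct, mul_comm]
  -- `y` is replaced by its representative in the chamber
  refine ⟨absDown y, absDown_mem_chamber y, fun S hS => ?_⟩
  have hmem : y ⬝ᵥ x ≤ absDown y ⬝ᵥ x := by
    obtain ⟨σ, A, e⟩ := eq_signedPerm_absDown y
    rw [dotProduct_comm, dotProduct_comm (absDown y) x]
    nth_rewrite 1 [e]
    exact dotProduct_signedPerm_le hxc.2 (absDown_mem_chamber y).2
      (monovary_of_mem_chamber hxc (absDown_mem_chamber y)) σ A
  have hS' : ∃ q ∈ lineupPolytope w (cube d), absDown y ⬝ᵥ setPoint w S = y ⬝ᵥ q := by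
    obtain ⟨σ, A, e⟩ := eq_signedPerm_absDown y
    refine ⟨_, signedPerm_mem w σ A (setPoint_mem w hS), ?_⟩
    conv_rhs => rw [e]
    simp only [dotProduct, signedPerm_apply]
    rw [← Equiv.sum_comp σ]
    refine Finset.sum_congr rfl fun i _ => ?_
    rcases signVec_eq_or A i with h | h <;> rw [h] <;> ring
  obtain ⟨q, hq, e⟩ := hS'
  rw [e]
  have h1 := hf q hq
  rw [hy] at h1 hu
  linarith

/-! ### Lists of sets of minimal cost -/

/-- `S` is a list of distinct sets of least cost with respect to `z`. -/
def IsOptimal {r d : ℕ} (w : Fin r → ℝ) (z : Fin d → ℝ) (S : Fin r → Finset (Fin d)) : Prop :=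
  Function.Injective S ∧ ∀ T : Fin r → Finset (Fin d), Function.Injective T →
    cost w z S ≤ cost w z T

theorem exists_isOptimal {r d : ℕ} (w : Fin r → ℝ) (z : Fin d → ℝ) (hr : r ≤ 2 ^ d) :
    ∃ S, IsOptimal w z S := by
  have hne : {S : Fin r → Finset (Fin d) | Function.Injective S}.Nonempty := by
    obtain ⟨f⟩ : Nonempty (Fin r ↪ Finset (Fin d)) :=
      Function.Embedding.nonempty_of_card_le (by simpa using hr)
    exact ⟨f, f.injective⟩
  obtain ⟨S, hS, h⟩ := Set.exists_min_image _ (cost w z) (Set.toFinite _) hne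
  exact ⟨S, hS, h⟩

theorem injective_update {α : Type*} {r : ℕ} {S : Fin r → α} (hS : Function.Injective S)
    (i : Fin r) {a : α} (ha : ∀ k, k ≠ i → S k ≠ a) :
    Function.Injective (Function.update S i a) := by
  intro k l h
  by_cases hk : k = i <;> by_cases hl : l = i
  · rw [hk, hl]
  · subst hk; simp [hl] at h; exact absurd h.symm (ha l hl)
  · subst hl; simp [hk] at h; exact absurd h (ha k hk)
  · simp [hk, hl] at h; exact hS h

theorem sum_mul_update {α : Type*} {r : ℕ} (w : Fin r → ℝ) (c : α → ℝ) (S : Fin r → α)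
    (i : Fin r) (a : α) :
    ∑ k, w k * c (Function.update S i a k) = ∑ k, w k * c (S k) - w i * (c (S i) - c a) := by
  have h : ∀ k, w k * c (Function.update S i a k) =
      w k * c (S k) - if k = i then w i * (c (S i) - c a) else 0 := by
    intro k
    by_cases hk : k = i
    · subst hk; simp; ring
    · simp [hk]
  simp [h, Finset.sum_sub_distrib]

/-- An optimal list contains every set lighter than one of its members. -/
theorem IsOptimal.exists_eq {r d : ℕ} {w : Fin r → ℝ} (hw : IsWeight w) {z : Fin d → ℝ}
    {S : Fin r → Finset (Fin d)} (hS : IsOptimal w z S) {i : Fin r} {A : Finset (Fin d)}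
    (h : ∑ j ∈ A, z j < ∑ j ∈ S i, z j) : ∃ k, S k = A := by
  by_contra! hA
  have h1 := hS.2 _ (injective_update hS.1 i fun k _ => hA k)
  unfold cost at h1
  rw [sum_mul_update w (fun B : Finset (Fin d) => ∑ j ∈ B, z j)] at h1
  have := mul_pos (hw.pos i) (sub_pos.2 h)
  linarith

/-- In an optimal list lighter sets come first. -/
theorem IsOptimal.lt_of_lt {r d : ℕ} {w : Fin r → ℝ} (hw : IsWeight w) {z : Fin d → ℝ}
    {S : Fin r → Finset (Fin d)} (hS : IsOptimal w z S) {i k : Fin r}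
    (h : ∑ j ∈ S k, z j < ∑ j ∈ S i, z j) : k < i := by
  by_contra! hik
  have hne : i ≠ k := by rintro rfl; exact lt_irrefl _ h
  have hlt : i < k := lt_of_le_of_ne hik hne
  have h1 := hS.2 (S ∘ Equiv.swap i k) (hS.1.comp (Equiv.swap i k).injective)
  have h2 : cost w z (S ∘ Equiv.swap i k) = cost w z S
      - (w i - w k) * (∑ j ∈ S i, z j - ∑ j ∈ S k, z j) := by
    have e : ∀ l, w l * ∑ j ∈ S (Equiv.swap i k l), z j = w l * ∑ j ∈ S l, z j
        - (if l = i then w i * (∑ j ∈ S i, z j - ∑ j ∈ S k, z j) else 0)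
        + (if l = k then w k * (∑ j ∈ S i, z j - ∑ j ∈ S k, z j) else 0) := by
      intro l
      by_cases hi : l = i
      · subst hi; simp [hne]; ring
      · by_cases hk : l = k
        · subst hk; simp [hi]; ring
        · simp [hi, hk, Equiv.swap_apply_of_ne_of_ne]
    unfold cost
    simp only [Function.comp, e, Finset.sum_add_distrib, Finset.sum_sub_distrib,
      Finset.sum_ite_eq', Finset.mem_univ, if_true]
    ring
  have := mul_pos (sub_pos.2 (hw.strictAnti hlt)) (sub_pos.2 h)
  linarith

/-- If `f` maps the sets with property `p` injectively to lighter sets with property `q`, then the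
members with property `q` of an optimal list carry more weight than those with property `p`:
the image of a member is a member, and an earlier one. -/
theorem IsOptimal.sum_weight_lt {r d : ℕ} {w : Fin r → ℝ} (hw : IsWeight w) {z : Fin d → ℝ}
    {S : Fin r → Finset (Fin d)} (hS : IsOptimal w z S) (p q : Finset (Fin d) → Prop)
    [DecidablePred p] [DecidablePred q] (f : Finset (Fin d) → Finset (Fin d))
    (hf : ∀ A, p A → q (f A) ∧ ∑ j ∈ f A, z j < ∑ j ∈ A, z j)
    (hinj : ∀ A B, p A → p B → f A = f B → A = B) (hex : ∃ i, p (S i)) :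
    ∑ i, (if p (S i) then w i else 0) < ∑ i, if q (S i) then w i else 0 := by
  have h : ∀ i, ∃ k, p (S i) → S k = f (S i) ∧ k < i := by
    intro i
    by_cases hi : p (S i)
    · obtain ⟨k, hk⟩ := hS.exists_eq hw (hf _ hi).2
      exact ⟨k, fun _ => ⟨hk, hS.lt_of_lt hw (by rw [hk]; exact (hf _ hi).2)⟩⟩
    · exact ⟨i, fun h => absurd h hi⟩
  choose g hg using h
  rw [← Finset.sum_filter, ← Finset.sum_filter]
  calc ∑ i with p (S i), w i < ∑ i with p (S i), w (g i) := by
        refine Finset.sum_lt_sum_of_nonempty ?_ fun i hi => ?_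
        · obtain ⟨i, hi⟩ := hex; exact ⟨i, by simpa using hi⟩
        · exact hw.strictAnti (hg i (by simpa using hi)).2
    _ = ∑ k ∈ (Finset.univ.filter fun i => p (S i)).image g, w k := by
        rw [Finset.sum_image]
        intro a ha b hb hab
        simp only [Finset.coe_filter, Finset.mem_univ, true_and, Set.mem_ofPred_eq] at ha hb
        refine hS.1 (hinj _ _ ha hb ?_)
        rw [← (hg a ha).1, ← (hg b hb).1, hab]
    _ ≤ _ := by
        refine Finset.sum_le_sum_of_subset_of_nonneg ?_ fun i _ _ => (hw.pos i).le
        intro k hk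
        simp only [Finset.mem_image, Finset.mem_filter, Finset.mem_univ, true_and] at hk ⊢
        obtain ⟨i, hi, rfl⟩ := hk
        rw [(hg i hi).1]; exact (hf _ hi).1

/-- The occupation vector of an optimal list is positive. -/
theorem IsOptimal.setPoint_pos {r d : ℕ} {w : Fin r → ℝ} (hw : IsWeight w) {z : Fin d → ℝ}
    {S : Fin r → Finset (Fin d)} (hS : IsOptimal w z S) {j : Fin d} (hj : 0 < z j) :
    0 < setPoint w S j := by
  rw [setPoint_apply hw]
  by_cases hex : ∃ i, j ∈ S i
  · have h := hS.sum_weight_lt hw (fun A => j ∈ A) (fun A => j ∉ A) (fun A => A.erase j)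
      (fun A hA => ⟨Finset.notMem_erase _ _, by
        rw [← Finset.sum_erase_add _ _ hA]; linarith⟩)
      (fun A B hA hB h => by rw [← Finset.insert_erase hA, ← Finset.insert_erase hB, h]) hex
    have h2 : ∑ i, (if j ∈ S i then w i else 0) + ∑ i, (if j ∉ S i then w i else 0) = 1 := by
      rw [← Finset.sum_add_distrib, ← hw.sum_eq_one]
      exact Finset.sum_congr rfl fun i _ => by by_cases h : j ∈ S i <;> simp [h]
    linarith
  · push Not at hex
    simp [hex]

theorem setPoint_eq_one_iff {r d : ℕ} {w : Fin r → ℝ} (hw : IsWeight w)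
    (S : Fin r → Finset (Fin d)) (j : Fin d) : setPoint w S j = 1 ↔ ∀ i, j ∉ S i := by
  rw [setPoint_apply hw]
  constructor
  · intro h
    have h0 : ∑ i, (if j ∈ S i then w i else 0) = 0 := by linarith
    rw [Finset.sum_eq_zero_iff_of_nonneg
      (fun i _ => by split_ifs <;> [exact (hw.pos i).le; rfl])] at h0
    intro i hi
    have := h0 i (Finset.mem_univ i)
    rw [if_pos hi] at this
    exact (hw.pos i).ne' this
  · intro h; simp [h]

/-- The occupation vector of an optimal list decreases strictly where it is not `1`. -/
theorem IsOptimal.setPoint_lt {r d : ℕ} {w : Fin r → ℝ} (hw : IsWeight w) {z : Fin d → ℝ}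
    {S : Fin r → Finset (Fin d)} (hS : IsOptimal w z S) {a b : Fin d} (hab : z b < z a)
    (hb : 0 < z b) (hb1 : setPoint w S b ≠ 1) : setPoint w S b < setPoint w S a := by
  have key : ∑ i, (if a ∈ S i ∧ b ∉ S i then w i else 0)
      < ∑ i, if b ∈ S i ∧ a ∉ S i then w i else 0 := by
    by_cases hex : ∃ i, a ∈ S i ∧ b ∉ S i
    · refine hS.sum_weight_lt hw (fun A => a ∈ A ∧ b ∉ A) (fun A => b ∈ A ∧ a ∉ A)
        (fun A => insert b (A.erase a)) ?_ ?_ hex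
      · rintro A ⟨ha, hbA⟩
        refine ⟨⟨Finset.mem_insert_self _ _, ?_⟩, ?_⟩
        · simp only [Finset.mem_insert, Finset.mem_erase, not_or]
          exact ⟨by rintro rfl; exact lt_irrefl _ hab, by simp⟩
        · rw [Finset.sum_insert (by simp [hbA]), ← Finset.sum_erase_add _ _ ha]; linarith
      · rintro A B ⟨haA, hbA⟩ ⟨haB, hbB⟩ h
        have h' := congrArg (fun C => insert a (C.erase b)) h
        simpa [Finset.erase_insert, hbA, hbB, Finset.insert_erase, haA, haB] using h'
    · -- no member contains `a` without `b`; members containing both would leave one behind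
      have hb2 : ∃ i, b ∈ S i := by
        by_contra! h
        exact hb1 ((setPoint_eq_one_iff hw S b).2 h)
      have hno : ∀ i, a ∉ S i := by
        intro i hi
        have hbi : b ∈ S i := by by_contra h; exact hex ⟨i, hi, h⟩
        obtain ⟨k, hk⟩ := hS.exists_eq hw (i := i) (A := (S i).erase b)
          (by rw [← Finset.sum_erase_add _ _ hbi]; linarith)
        refine hex ⟨k, ?_, ?_⟩
        · rw [hk, Finset.mem_erase]; exact ⟨by rintro rfl; exact lt_irrefl _ hab, hi⟩
        · rw [hk]; exact Finset.notMem_erase _ _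
      obtain ⟨i, hi⟩ := hb2
      simp only [hno, false_and, if_false, Finset.sum_const_zero, not_false_eq_true, and_true]
      refine Finset.sum_pos' (fun k _ => by split_ifs <;> [exact (hw.pos k).le; rfl])
        ⟨i, Finset.mem_univ _, by rw [if_pos hi]; exact hw.pos i⟩
  rw [setPoint_apply hw, setPoint_apply hw]
  have e : ∑ i, (if a ∈ S i then w i else 0) + ∑ i, (if b ∈ S i ∧ a ∉ S i then w i else 0) =
      ∑ i, (if b ∈ S i then w i else 0) + ∑ i, (if a ∈ S i ∧ b ∉ S i then w i else 0) := by
    rw [← Finset.sum_add_distrib, ← Finset.sum_add_distrib]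
    exact Finset.sum_congr rfl fun i _ => by
      by_cases h1 : a ∈ S i <;> by_cases h2 : b ∈ S i <;> simp [h1, h2]
  linarith

theorem IsOptimal.setPoint_eq_one {r d : ℕ} {w : Fin r → ℝ} (hw : IsWeight w) {z : Fin d → ℝ}
    {S : Fin r → Finset (Fin d)} (hS : IsOptimal w z S) {a b : Fin d} (hab : z b < z a)
    (hb1 : setPoint w S b = 1) : setPoint w S a = 1 := by
  rw [setPoint_eq_one_iff hw] at hb1 ⊢
  intro i hi
  obtain ⟨k, hk⟩ := hS.exists_eq hw (i := i) (A := insert b ((S i).erase a)) (by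
    rw [Finset.sum_insert (by simp [hb1 i]), ← Finset.sum_erase_add _ _ hi]; linarith)
  exact hb1 k (by rw [hk]; exact Finset.mem_insert_self _ _)

/-- Given at least `r` good elements, none dearer than a bad one, a list of `r` distinct elements
can be made to consist of elements that are not bad, without increasing its cost. -/
theorem exists_injective_not_bad {α : Type*} [DecidableEq α] {r : ℕ} {w : Fin r → ℝ}
    (hw : ∀ i, 0 ≤ w i) (c : α → ℝ) (bad : α → Prop) (E : Finset α) (hE : r ≤ E.card)
    (hgood : ∀ e ∈ E, ¬ bad e) (hle : ∀ a, bad a → ∀ e ∈ E, c e ≤ c a) (T : Fin r → α)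
    (hT : Function.Injective T) :
    ∃ T' : Fin r → α, Function.Injective T' ∧ (∀ i, ¬ bad (T' i)) ∧
      ∑ i, w i * c (T' i) ≤ ∑ i, w i * c (T i) := by
  classical
  induction hn : (Finset.univ.filter fun i => bad (T i)).card generalizing T with
  | zero =>
    refine ⟨T, hT, fun i hi => ?_, le_rfl⟩
    rw [Finset.card_eq_zero] at hn
    have : i ∈ Finset.univ.filter fun i => bad (T i) := by simpa using hi
    simp [hn] at this
  | succ n ih =>
    obtain ⟨i, hi⟩ : (Finset.univ.filter fun i => bad (T i)).Nonempty := by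
      rw [← Finset.card_pos]; omega
    have hbad : bad (T i) := by simpa using hi
    -- the list has fewer than `r` good members, so some member of `E` is not listed
    obtain ⟨e, heE, he⟩ : ∃ e ∈ E, ∀ k, T k ≠ e := by
      by_contra! h
      have hsub : E ⊆ (Finset.univ.erase i).image T := by
        intro e he
        obtain ⟨k, hk⟩ := h e he
        refine Finset.mem_image.2 ⟨k, Finset.mem_erase.2 ⟨?_, Finset.mem_univ _⟩, hk⟩
        rintro rfl
        exact hgood e he (hk ▸ hbad)
      have h1 := (Finset.card_le_card hsub).trans Finset.card_image_le
      rw [Finset.card_erase_of_mem (Finset.mem_univ i), Finset.card_univ, Fintype.card_fin] at h1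
      have := i.pos
      omega
    have hset : (Finset.univ.filter fun k => bad (Function.update T i e k)) =
        (Finset.univ.filter fun k => bad (T k)).erase i := by
      ext k
      by_cases hk : k = i
      · subst hk; simp [hgood e heE]
      · simp [hk]
    obtain ⟨T', h1, h2, h3⟩ := ih (Function.update T i e)
      (injective_update hT i fun k _ => he k)
      (by rw [hset, Finset.card_erase_of_mem hi, hn]; rfl)
    refine ⟨T', h1, h2, h3.trans ?_⟩
    rw [sum_mul_update w c]
    have := mul_nonneg (hw i) (sub_nonneg.2 (hle _ hbad e heE))
    linarith

/-! ### Faces met by points with coordinates below one -/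

theorem le_one_of_mem_lineupPolytope {r d : ℕ} {w : Fin r → ℝ} (hw : IsWeight w)
    {q : Fin d → ℝ} (hq : q ∈ lineupPolytope w (cube d)) (j : Fin d) : q j ≤ 1 := by
  have := dotProduct_le_of_mem (z := Pi.single j 1) (c := 1)
    (fun T _ => by simpa using setPoint_le_one hw T j) hq
  simpa using this

/-- If `b` is used by no member of a `y`-optimal list and `y b < y a`, then the face of the lineup
polytope in direction `y` lies in the hyperplane where the coordinate `a` equals `1`. -/
theorem IsOptimal.dotProduct_lt {r d : ℕ} {w : Fin r → ℝ} (hw : IsWeight w) {y : Fin d → ℝ}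
    {S : Fin r → Finset (Fin d)} (hS : IsOptimal w y S) (hy : ∀ j, 0 ≤ y j) {a b : Fin d}
    (hab : y b < y a) (hb : ∀ i, b ∉ S i) {q : Fin d → ℝ}
    (hq : q ∈ lineupPolytope w (cube d)) (hqa : q a < 1) :
    y ⬝ᵥ q < y ⬝ᵥ setPoint w S := by
  classical
  have hSm : ∀ i, ∑ j ∈ S i, y j ≤ y b := by
    intro i
    by_contra! h
    obtain ⟨k, hk⟩ := hS.exists_eq hw (A := {b}) (i := i) (by simpa using h)
    exact hb k (by rw [hk]; simp)
  have hel : ∀ {A : Finset (Fin d)} {j : Fin d}, j ∈ A → y j ≤ ∑ j ∈ A, y j :=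
    fun hj => Finset.single_le_sum (f := y) (fun j _ => hy j) hj
  -- `y` truncated at the height `y b` has the same optimal list
  set t : Fin d → ℝ := fun j => min (y j) (y b) with ht
  have ht0 : ∀ j, 0 ≤ t j := fun j => le_min (hy j) (hy b)
  have hcost : ∀ T : Fin r → Finset (Fin d), Function.Injective T →
      cost w t S ≤ cost w t T := by
    intro T hT
    obtain ⟨T', hT', hT'm, hle⟩ := exists_injective_not_bad (fun i => (hw.pos i).le)
      (fun A : Finset (Fin d) => ∑ j ∈ A, t j) (fun A => y b < ∑ j ∈ A, y j)
      (Finset.univ.image S) (by rw [Finset.card_image_of_injective _ hS.1]; simp)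
      (by
        intro e he
        obtain ⟨i, -, rfl⟩ := Finset.mem_image.1 he
        exact not_lt.2 (hSm i))
      (by
        intro A hA e he
        obtain ⟨i, -, rfl⟩ := Finset.mem_image.1 he
        refine (Finset.sum_le_sum fun j _ => min_le_left _ _).trans ((hSm i).trans ?_)
        by_cases h : ∃ j ∈ A, y b ≤ y j
        · obtain ⟨j, hj, hbj⟩ := h
          calc y b = t j := by simp [ht, hbj]
            _ ≤ _ := Finset.single_le_sum (f := t) (fun j _ => ht0 j) hj
        · push Not at h
          refine hA.le.trans (Finset.sum_le_sum fun j hj => ?_)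
          simp [ht, (h j hj).le]) T hT
    calc cost w t S ≤ cost w y S := Finset.sum_le_sum fun i _ =>
          mul_le_mul_of_nonneg_left (Finset.sum_le_sum fun j _ => min_le_left _ _) (hw.pos i).le
      _ ≤ cost w y T' := hS.2 T' hT'
      _ ≤ cost w t T' := Finset.sum_le_sum fun i _ =>
          mul_le_mul_of_nonneg_left (Finset.sum_le_sum fun j hj =>
            le_min le_rfl ((hel hj).trans (not_lt.1 (hT'm i)))) (hw.pos i).le
      _ ≤ _ := hle
  have h1 : t ⬝ᵥ q ≤ t ⬝ᵥ setPoint w S := by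
    refine dotProduct_le_of_mem (fun T hT => ?_) hq
    rw [dotProduct_setPoint hw, dotProduct_setPoint hw]
    have := hcost T hT
    linarith
  have h2 : (y - t) ⬝ᵥ q < (y - t) ⬝ᵥ setPoint w S := by
    refine Finset.sum_lt_sum (fun j _ => ?_) ⟨a, Finset.mem_univ a, ?_⟩
    · have hyt : 0 ≤ y j - t j := sub_nonneg.2 (min_le_left _ _)
      rcases le_or_gt (y j) (y b) with h | h
      · simp [ht, h]
      · have : setPoint w S j = 1 := (setPoint_eq_one_iff hw S j).2 fun i hj =>
          absurd (hel hj) (not_le.2 ((hSm i).trans_lt h))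
        rw [this]
        exact mul_le_mul_of_nonneg_left (le_one_of_mem_lineupPolytope hw hq j) hyt
    · have : setPoint w S a = 1 := (setPoint_eq_one_iff hw S a).2 fun i hj =>
        absurd (hel hj) (not_le.2 ((hSm i).trans_lt hab))
      rw [this]
      refine mul_lt_mul_of_pos_left hqa ?_
      simp [ht, hab]
  rw [sub_dotProduct, sub_dotProduct] at h2
  linarith

theorem exists_add_smul_mem_of_mem_nhds {d : ℕ} {P : Set (Fin d → ℝ)} {s : Fin d → ℝ}
    (h : P ∈ 𝓝 s) (x : Fin d → ℝ) : ∃ δ > (0 : ℝ), ∀ t : ℝ, 0 ≤ t → t < δ →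
    s + t • x ∈ P := by
  have hc : Tendsto (fun t : ℝ => s + t • x) (𝓝 0) (𝓝 s) := by
    have : Continuous (fun t : ℝ => s + t • x) := by fun_prop
    simpa using this.tendsto 0
  obtain ⟨δ, hδ, hb⟩ := Metric.eventually_nhds_iff.1 (hc.eventually h)
  exact ⟨δ, hδ, fun t h0 ht => hb (by simpa [abs_of_nonneg h0] using ht)⟩

/-- At a boundary point some inequality of an H-representation is attained. -/
theorem IsHRep.exists_tight {r d : ℕ} {w : Fin r → ℝ} {I : Set ((Fin d → ℝ) × ℝ)}
    (hI : IsHRep (lineupPolytope w (cube d)) I) {s : Fin d → ℝ}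
    (hs : s ∈ lineupPolytope w (cube d)) (hn : lineupPolytope w (cube d) ∉ 𝓝 s) :
    ∃ p ∈ I, p.1 ≠ 0 ∧ ∃ σ A, p.1 ⬝ᵥ signedPerm σ A s = p.2 := by
  by_contra! h
  refine hn ?_
  have h1 : ∀ p ∈ I, ∀ σ A, ∀ᶠ x in 𝓝 s, p.1 ⬝ᵥ signedPerm σ A x ≤ p.2 := by
    intro p hp σ A
    have hle := (hI.mem_iff s).1 hs p hp σ A
    by_cases h0 : p.1 = 0
    · rw [h0, zero_dotProduct] at hle
      exact Eventually.of_forall fun x => by rwa [h0, zero_dotProduct]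
    · have hlt := lt_of_le_of_ne hle (h p hp h0 σ A)
      have hc : Continuous fun x => p.1 ⬝ᵥ signedPerm σ A x :=
        continuous_const.dotProduct (signedPerm σ A).continuous_of_finiteDimensional
      exact (hc.continuousAt.eventually_lt continuousAt_const hlt).mono fun x hx => hx.le
  have h2 : ∀ᶠ x in 𝓝 s, ∀ p ∈ I, ∀ σ A, p.1 ⬝ᵥ signedPerm σ A x ≤ p.2 := by
    rw [eventually_all_finite hI.1]
    intro p hp
    simp only [eventually_all]
    exact h1 p hp
  exact h2.mono fun x hx => (hI.mem_iff x).2 hx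

/-- When a facet of the cube has at least `r` vertices, every H-representation contains a positive
multiple of the inequality `x₁ ≤ 1`: some `(c • e₁, b)` with `0 < c` and `b ≤ c`. -/
theorem IsHRep.exists_axis {r d : ℕ} {w : Fin r → ℝ} (hw : IsWeight w)
    {I : Set ((Fin d → ℝ) × ℝ)} (hI : IsHRep (lineupPolytope w (cube d)) I) (hd : 0 < d)
    (hr : r ≤ 2 ^ (d - 1)) :
    ∃ p ∈ I, (∀ i : Fin d, (i : ℕ) ≠ 0 → p.1 i = 0) ∧ 0 < p.1 ⟨0, hd⟩ ∧
      p.2 ≤ p.1 ⟨0, hd⟩ := by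
  classical
  set o : Fin d := ⟨0, hd⟩ with ho
  -- a direction for which every set containing the first coordinate is dearer than all the others
  set z : Fin d → ℝ := fun i => if i = o then d else 1 with hz
  have hzpos : ∀ i, 0 < z i := by
    intro i; simp only [hz]; split_ifs <;> [exact_mod_cast hd; exact one_pos]
  obtain ⟨S, hS⟩ := exists_isOptimal w z (hr.trans (Nat.pow_le_pow_right two_pos (Nat.sub_le d 1)))
  have hSo : ∀ i, o ∉ S i := by
    intro i hi
    have hsub : (Finset.univ.erase o).powerset ⊆ (Finset.univ.erase i).image S := by
      intro A hA
      have hA' := Finset.mem_powerset.1 hA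
      have hoA : o ∉ A := fun h => Finset.notMem_erase o _ (hA' h)
      have h1 : ∑ j ∈ A, z j < ∑ j ∈ S i, z j := by
        calc ∑ j ∈ A, z j = A.card := by
              rw [Finset.sum_congr rfl (g := fun _ => (1 : ℝ)) fun j hj => ?_]
              · simp
              · simp only [hz]; rw [if_neg]; rintro rfl; exact hoA hj
          _ < d := by
              have := Finset.card_le_card hA'
              rw [Finset.card_erase_of_mem (Finset.mem_univ o), Finset.card_univ,
                Fintype.card_fin] at this
              exact_mod_cast (show A.card < d by omega)
          _ = z o := by simp [hz]
          _ ≤ _ := Finset.single_le_sum (f := z) (fun j _ => (hzpos j).le) hi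
      obtain ⟨k, hk⟩ := hS.exists_eq hw h1
      refine Finset.mem_image.2 ⟨k, Finset.mem_erase.2 ⟨?_, Finset.mem_univ _⟩, hk⟩
      rintro rfl
      exact hoA (hk ▸ hi)
    have h2 := (Finset.card_le_card hsub).trans Finset.card_image_le
    rw [Finset.card_powerset, Finset.card_erase_of_mem (Finset.mem_univ o),
      Finset.card_erase_of_mem (Finset.mem_univ i), Finset.card_univ, Finset.card_univ,
      Fintype.card_fin, Fintype.card_fin] at h2
    have := i.pos
    omega
  set v := setPoint w S with hv
  have hv0 : v o = 1 := (setPoint_eq_one_iff hw S o).2 hSo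
  have hvpos : ∀ i, 0 < v i := fun i => hS.setPoint_pos hw (hzpos i)
  have hvP : v ∈ lineupPolytope w (cube d) := setPoint_mem w hS.1
  set v' := signedPerm (Equiv.refl _) (Finset.univ.erase o) v with hv'
  have hv'P : v' ∈ lineupPolytope w (cube d) := signedPerm_mem w _ _ hvP
  -- a point in the relative interior of the face where the first coordinate is `1`
  set q : Fin d → ℝ := (3 / 4 : ℝ) • v + (1 / 4 : ℝ) • v' with hq
  have hqP : q ∈ lineupPolytope w (cube d) :=
    convex_lineupPolytope w _ hvP hv'P (by norm_num) (by norm_num) (by norm_num)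
  have hq0 : q o = 1 := by
    simp [hq, hv', signedPerm_apply, signVec, hv0]; norm_num
  have hqi : ∀ i, i ≠ o → q i = v i / 2 := by
    intro i hi
    simp [hq, hv', signedPerm_apply, signVec, hi]; ring
  have hn : lineupPolytope w (cube d) ∉ 𝓝 q := by
    intro h
    obtain ⟨δ, hδ, h⟩ := exists_add_smul_mem_of_mem_nhds h (Pi.single o 1)
    have := le_one_of_mem_lineupPolytope hw (h (δ / 2) (by positivity) (by linarith)) o
    simp [hq0] at this
    linarith
  obtain ⟨p, hp, hp0, σ, A, hb⟩ := hI.exists_tight hqP hn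
  have hpc := hI.2.1 p hp
  set i₀ := σ.symm o with hi₀
  have hσ : ∀ i, i ≠ i₀ → σ i ≠ o := fun i hi h => hi (by rw [hi₀, ← h]; simp)
  -- a suitable signed copy of `v` dominates that of `q`, strictly away from `i₀`, and still
  -- satisfies the inequality, so `p.1` vanishes there
  have hzero : ∀ i, i ≠ i₀ → p.1 i = 0 := by
    have h1 := (hI.mem_iff v).1 hvP p hp σ (A ∩ {i₀})
    have h2 : p.1 ⬝ᵥ signedPerm σ (A ∩ {i₀}) v - p.1 ⬝ᵥ signedPerm σ A q =
        ∑ i, p.1 i * (signVec (A ∩ {i₀}) i * v (σ i) - signVec A i * q (σ i)) := by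
      simp only [dotProduct, signedPerm_apply, ← Finset.sum_sub_distrib, mul_sub]
    have h3 : ∀ i, 0 ≤ p.1 i * (signVec (A ∩ {i₀}) i * v (σ i) - signVec A i * q (σ i)) := by
      intro i
      refine mul_nonneg (hpc.2 i) ?_
      by_cases hi : i = i₀
      · subst hi
        simp [signVec, hi₀, hv0, hq0]
      · rw [hqi _ (hσ i hi)]
        have := hvpos (σ i)
        rcases signVec_eq_or A i with h | h <;> rw [h] <;> simp [signVec, hi] <;> linarith
    have h4 : ∑ i, p.1 i * (signVec (A ∩ {i₀}) i * v (σ i) - signVec A i * q (σ i)) = 0 :=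
      le_antisymm (by rw [← h2]; linarith) (Finset.sum_nonneg fun i _ => h3 i)
    intro i hi
    have h5 := (Finset.sum_eq_zero_iff_of_nonneg fun i _ => h3 i).1 h4 i (Finset.mem_univ i)
    rcases mul_eq_zero.1 h5 with h | h
    · exact h
    · rw [hqi _ (hσ i hi)] at h
      have := hvpos (σ i)
      rcases signVec_eq_or A i with h' | h' <;> rw [h'] at h <;> simp [signVec, hi] at h <;>
        linarith
  have hpo : p.1 o ≠ 0 := by
    intro h
    refine hp0 (funext fun i => le_antisymm ?_ (hpc.2 i))
    exact (hpc.1 (show o ≤ i from Nat.zero_le _)).trans h.le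
  have hoi : o = i₀ := by
    by_contra h
    exact hpo (hzero o h)
  refine ⟨p, hp, fun i hi => hzero i ?_, lt_of_le_of_ne (hpc.2 o) hpo.symm, ?_⟩
  · rw [← hoi]; rintro rfl; exact hi rfl
  · rw [← hb, dotProduct, Finset.sum_eq_single i₀]
    · rw [signedPerm_apply, show σ i₀ = o by simp [hi₀], hq0, ← hoi]
      have := hpc.2 o
      rcases signVec_eq_or A o with h | h <;> rw [h] <;> linarith
    · intro i _ hi; rw [hzero i hi, zero_mul]
    · simp

/-! ### Unsorted points below the inequalities -/

/-- The case of `IsHRep.exists_dotProduct_le` in which `z` is in the interior of the chamber and the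
coordinates of `x` are less than `1`. The segment from a multiple of a `z`-optimal vertex towards `x`
cannot leave the polytope near that vertex. -/
theorem IsHRep.exists_dotProduct_le_of_strict {r d : ℕ} {w : Fin r → ℝ} (hw : IsWeight w)
    (hr : r ≤ 2 ^ d) {I : Set ((Fin d → ℝ) × ℝ)} (hI : IsHRep (lineupPolytope w (cube d)) I)
    {x : Fin d → ℝ} (hx1 : ∀ j, x j < 1) (hx : ∀ p ∈ I, p.1 ⬝ᵥ x ≤ p.2) {z : Fin d → ℝ}
    (hz : StrictAnti z) (hz0 : ∀ j, 0 < z j) :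
    ∃ S : Fin r → Finset (Fin d), Function.Injective S ∧ z ⬝ᵥ x ≤ z ⬝ᵥ setPoint w S := by
  classical
  by_contra! hcon
  obtain ⟨S, hS⟩ := exists_isOptimal w z hr
  set v := setPoint w S with hv
  have hvP : v ∈ lineupPolytope w (cube d) := setPoint_mem w hS.1
  have hvpos : ∀ j, 0 < v j := fun j => hS.setPoint_pos hw (hz0 j)
  have hvle : ∀ j, v j ≤ 1 := setPoint_le_one hw S
  have hvlt : ∀ i j, i < j → v j ≠ 1 → v j < v i := fun i j hij hj =>
    hS.setPoint_lt hw (hz hij) (hz0 j) hj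
  have hvmax : ∀ q ∈ lineupPolytope w (cube d), z ⬝ᵥ q ≤ z ⬝ᵥ v := fun q hq =>
    dotProduct_le_of_mem (fun T hT => by
      rw [hv, dotProduct_setPoint hw, dotProduct_setPoint hw]
      have := hS.2 T hT
      linarith) hq
  have hvch : v ∈ chamber d := by
    refine ⟨fun i j hij => ?_, fun j => (hvpos j).le⟩
    rcases hij.eq_or_lt with rfl | hij
    · exact le_rfl
    · by_cases h : v j = 1
      · rw [h, hv, hS.setPoint_eq_one hw (hz hij) h]
      · exact (hvlt i j hij h).le
  -- near `v`, points are positive and sorted as `v` is wherever the coordinates of `v` are not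
  -- tied at `1`, and only inequalities attained at `v` can be attained
  have hU : ∀ᶠ s in 𝓝 v, (∀ j, 0 < s j) ∧ (∀ i j, i < j → v j ≠ 1 → s j < s i) ∧
      ∀ p ∈ I, ∀ σ A, p.1 ⬝ᵥ signedPerm σ A v < p.2 → p.1 ⬝ᵥ signedPerm σ A s < p.2 := by
    refine Eventually.and ?_ (Eventually.and ?_ ?_)
    · exact eventually_all.2 fun j =>
        continuousAt_const.eventually_lt (continuous_apply j).continuousAt (hvpos j)
    · simp only [eventually_all]
      intro i j hij hj
      exact (continuous_apply j).continuousAt.eventually_lt (continuous_apply i).continuousAt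
        (hvlt i j hij hj)
    · rw [eventually_all_finite hI.1]
      intro p hp
      simp only [eventually_all]
      intro σ A hlt
      have hc : Continuous fun x => p.1 ⬝ᵥ signedPerm σ A x :=
        continuous_const.dotProduct (signedPerm σ A).continuous_of_finiteDimensional
      exact hc.continuousAt.eventually_lt continuousAt_const hlt
  obtain ⟨ε, hε0, hε1, hεU⟩ : ∃ ε : ℝ, 0 < ε ∧ ε < 1 ∧ ∀ τ, 0 ≤ τ → τ ≤ ε →
      (∀ j, 0 < ((1 - ε) • v + τ • x) j) ∧
      (∀ i j, i < j → v j ≠ 1 → ((1 - ε) • v + τ • x) j < ((1 - ε) • v + τ • x) i) ∧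
      ∀ p ∈ I, ∀ σ A, p.1 ⬝ᵥ signedPerm σ A v < p.2 →
        p.1 ⬝ᵥ signedPerm σ A ((1 - ε) • v + τ • x) < p.2 := by
    have hc : Continuous fun e : ℝ × ℝ => (1 - e.1) • v + e.2 • x := by fun_prop
    have ht := hc.tendsto (0, 0)
    simp only [sub_zero, one_smul, zero_smul, add_zero] at ht
    obtain ⟨δ, hδ, hb⟩ := Metric.eventually_nhds_iff.1 (ht.eventually hU)
    have hm : 0 < min (δ / 2) (1 / 2) := by positivity
    refine ⟨min (δ / 2) (1 / 2), hm, by linarith [min_le_right (δ / 2) (1 / 2 : ℝ)],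
      fun τ h0 hτ => ?_⟩
    refine hb (y := (min (δ / 2) (1 / 2), τ)) ?_
    rw [Prod.dist_eq, max_lt_iff]
    simp only [Real.dist_eq, sub_zero]
    rw [abs_of_pos hm, abs_of_nonneg h0]
    have := min_le_left (δ / 2) (1 / 2 : ℝ)
    constructor <;> linarith
  -- the last point `s` of the polytope on the segment from `(1 - ε) v` towards `x`
  have hcl : IsCompact (Set.Icc 0 ε ∩
      (fun τ : ℝ => (1 - ε) • v + τ • x) ⁻¹' lineupPolytope w (cube d)) :=
    isCompact_Icc.inter_right ((isClosed_lineupPolytope_cube w).preimage (by fun_prop))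
  have hne : (Set.Icc 0 ε ∩
      (fun τ : ℝ => (1 - ε) • v + τ • x) ⁻¹' lineupPolytope w (cube d)).Nonempty := by
    refine ⟨0, ⟨le_rfl, hε0.le⟩, ?_⟩
    have hneg := signedPerm_mem w (Equiv.refl _) Finset.univ hvP
    have := convex_lineupPolytope w (cube d) hvP hneg (a := 1 - ε / 2) (b := ε / 2)
      (by linarith) (by linarith) (by ring)
    rw [Set.mem_preimage]
    convert this using 1
    ext j
    simp [signedPerm_apply, signVec]; ring
  obtain ⟨τ, ⟨⟨hτ0, hτε⟩, hsP⟩, hmax⟩ := hcl.exists_isGreatest hne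
  obtain ⟨hspos, hslt, hstight⟩ := hεU τ hτ0 hτε
  set s := (1 - ε) • v + τ • x with hs
  have hsP : s ∈ lineupPolytope w (cube d) := hsP
  have hdot : ∀ y : Fin d → ℝ, y ⬝ᵥ s = (1 - ε) * y ⬝ᵥ v + τ * y ⬝ᵥ x := fun y => by
    simp [hs, dotProduct_add, dotProduct_smul]
  have hτlt : τ < ε := by
    refine lt_of_le_of_ne hτε fun h => ?_
    have h1 := hvmax s hsP
    rw [hdot, h] at h1
    have := mul_lt_mul_of_pos_left (hcon S hS.1) hε0
    linarith
  have hn : lineupPolytope w (cube d) ∉ 𝓝 s := by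
    intro h
    obtain ⟨δ, hδ, h⟩ := exists_add_smul_mem_of_mem_nhds h x
    have hm : 0 < min (δ / 2) (ε - τ) := lt_min (by positivity) (by linarith)
    have h1 := h _ hm.le (by linarith [min_le_left (δ / 2) (ε - τ)])
    have h2 := hmax (a := τ + min (δ / 2) (ε - τ))
      ⟨⟨by linarith, by linarith [min_le_right (δ / 2) (ε - τ)]⟩, by
        rw [Set.mem_preimage, add_smul, ← add_assoc]; exact h1⟩
    linarith
  obtain ⟨p, hp, hp0, σ, A, hb⟩ := hI.exists_tight hsP hn
  have hpc := hI.2.1 p hp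
  have hpv : p.1 ⬝ᵥ v = p.2 := by
    refine le_antisymm (hI.dotProduct_le hp hvP) ?_
    have h1 : p.2 ≤ p.1 ⬝ᵥ signedPerm σ A v := by
      by_contra! h
      exact (hstight p hp σ A h).ne hb
    exact h1.trans (dotProduct_signedPerm_le hpc.2 hvch.2 (monovary_of_mem_chamber hpc hvch) σ A)
  have hSp : IsOptimal w p.1 S := by
    refine ⟨hS.1, fun T hT => ?_⟩
    have := hI.dotProduct_le hp (setPoint_mem w hT)
    rw [← hpv, hv, dotProduct_setPoint hw, dotProduct_setPoint hw] at this
    linarith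
  -- the attained inequality is symmetric in the coordinates in which `v` is `1`
  have hconst : ∀ a b, v b = 1 → p.1 a ≤ p.1 b := by
    intro a b hvb
    by_contra! hlt
    refine absurd hb (ne_of_lt ?_)
    rw [← hpv]
    refine hSp.dotProduct_lt hw hpc.2 hlt ((setPoint_eq_one_iff hw S b).1 hvb)
      (signedPerm_mem w σ A hsP) ?_
    rw [signedPerm_apply]
    have h1 := hspos (σ a)
    have h2 : s (σ a) < 1 := by
      have h3 : s (σ a) = (1 - ε) * v (σ a) + τ * x (σ a) := by simp [hs]
      have h4 := mul_le_mul_of_nonneg_left (hvle (σ a)) (sub_nonneg.2 hε1.le)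
      have h5 := mul_le_mul_of_nonneg_left (hx1 (σ a)).le hτ0
      linarith
    rcases signVec_eq_or A a with h | h <;> rw [h] <;> linarith
  have hmono : Monovary p.1 s := by
    intro i j hij
    by_cases hvj : v j = 1
    · exact hconst i j hvj
    · refine hpc.1 (not_lt.1 fun h => ?_)
      exact lt_asymm hij (hslt i j h hvj)
  have hle : p.2 ≤ p.1 ⬝ᵥ s := by
    rw [← hb]
    exact dotProduct_signedPerm_le hpc.2 (fun j => (hspos j).le) hmono σ A
  have hbpos : 0 < p.2 := by
    rw [← hpv]
    obtain ⟨j, hj⟩ := Function.ne_iff.1 hp0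
    exact Finset.sum_pos' (fun i _ => mul_nonneg (hpc.2 i) (hvpos i).le)
      ⟨j, Finset.mem_univ _, mul_pos (lt_of_le_of_ne (hpc.2 j) (Ne.symm hj)) (hvpos j)⟩
  rw [hdot, hpv] at hle
  have h1 := mul_le_mul_of_nonneg_left (hx p hp) hτ0
  have h2 := mul_pos (sub_pos.2 hτlt) hbpos
  linarith

/-- A point with coordinates at most `1` that satisfies the inequalities of an H-representation
satisfies all valid inequalities with normal vector in the chamber, even when its coordinates are
not sorted. -/
theorem IsHRep.exists_dotProduct_le {r d : ℕ} {w : Fin r → ℝ} (hw : IsWeight w)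
    (hr : r ≤ 2 ^ d) {I : Set ((Fin d → ℝ) × ℝ)} (hI : IsHRep (lineupPolytope w (cube d)) I)
    {x : Fin d → ℝ} (hx1 : ∀ j, x j ≤ 1) (hx : ∀ p ∈ I, p.1 ⬝ᵥ x ≤ p.2) {z : Fin d → ℝ}
    (hz : z ∈ chamber d) :
    ∃ S : Fin r → Finset (Fin d), Function.Injective S ∧ z ⬝ᵥ x ≤ z ⬝ᵥ setPoint w S := by
  by_contra! hcon
  -- move `z` into the interior of the chamber and the coordinates of `x` below `1`
  set ρ : Fin d → ℝ := fun j => (d : ℝ) - j with hρ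
  have hev : ∀ᶠ t in 𝓝[>] (0 : ℝ), ∀ S : Fin r → Finset (Fin d), Function.Injective S →
      (z + t • ρ) ⬝ᵥ setPoint w S < (z + t • ρ) ⬝ᵥ (x - t • 1) := by
    simp only [eventually_all]
    intro S hS
    refine Tendsto.eventually_lt (tendsto_nhdsWithin_of_tendsto_nhds
      ((Continuous.dotProduct (by fun_prop) (by fun_prop)).tendsto 0))
      (tendsto_nhdsWithin_of_tendsto_nhds
      ((Continuous.dotProduct (by fun_prop) (by fun_prop)).tendsto 0)) ?_
    simpa using hcon S hS
  obtain ⟨t, ht, ht0⟩ := (hev.and self_mem_nhdsWithin).exists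
  have ht0 : 0 < t := ht0
  obtain ⟨S, hS, hle⟩ := hI.exists_dotProduct_le_of_strict hw hr (x := x - t • 1)
    (z := z + t • ρ) (fun j => by have := hx1 j; simp; linarith)
    (fun p hp => by
      have h1 : 0 ≤ p.1 ⬝ᵥ (1 : Fin d → ℝ) :=
        Finset.sum_nonneg fun j _ => mul_nonneg ((hI.2.1 p hp).2 j) zero_le_one
      rw [dotProduct_sub, dotProduct_smul, smul_eq_mul]
      have := mul_nonneg ht0.le h1
      linarith [hx p hp])
    (fun i j hij => by
      have h1 := hz.1 hij.le
      have h2 : (i : ℝ) < j := by exact_mod_cast hij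
      have := mul_lt_mul_of_pos_left h2 ht0
      simp only [hρ, Pi.add_apply, Pi.smul_apply, smul_eq_mul]
      linarith)
    (fun j => by
      have h1 := hz.2 j
      have h2 : (j : ℝ) < d := by exact_mod_cast j.isLt
      have := mul_pos ht0 (sub_pos.2 h2)
      simp only [hρ, Pi.add_apply, Pi.smul_apply, smul_eq_mul]
      linarith)
  exact (ht S hS).not_ge hle

/-! ### Lifting inequalities and lists of vertices -/

theorem prependFirst_castAdd {N : ℕ} (hN : 0 < N) (k : ℕ) (y : Fin N → ℝ) (j : Fin k) :
    prependFirst hN (k + N) y (Fin.castAdd N j) = y ⟨0, hN⟩ := by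
  simp [prependFirst]

theorem prependFirst_natAdd {N : ℕ} (hN : 0 < N) (k : ℕ) (y : Fin N → ℝ) (j : Fin N) :
    prependFirst hN (k + N) y (Fin.natAdd k j) = y j := by
  simp [prependFirst]

theorem prependFirst_mem_chamber {N : ℕ} (hN : 0 < N) (M : ℕ) {y : Fin N → ℝ}
    (hy : y ∈ chamber N) : prependFirst hN M y ∈ chamber M := by
  refine ⟨fun i j hij => ?_, fun i => ?_⟩
  · have hij' : (i : ℕ) ≤ j := hij
    unfold prependFirst
    split_ifs with h1 h2 h2
    · exact hy.1 (Nat.zero_le _)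
    · omega
    · exact hy.1 (Nat.zero_le _)
    · exact hy.1 (Fin.mk_le_mk.2 (by omega))
  · unfold prependFirst; split_ifs <;> exact hy.2 _

theorem axisVector_mem_chamber {N : ℕ} (hN : 0 < N) (M : ℕ) {y : Fin N → ℝ}
    (hy : y ∈ chamber N) : axisVector hN M y ∈ chamber M := by
  refine ⟨fun i j hij => ?_, fun i => ?_⟩
  · have hij' : (i : ℕ) ≤ j := hij
    unfold axisVector
    split_ifs with h1 h2 h2
    · exact le_rfl
    · omega
    · exact hy.2 _
    · exact le_rfl
  · unfold axisVector; split_ifs <;> [exact hy.2 _; exact le_rfl]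

theorem liftIneq_of_axis {N : ℕ} (hN : 0 < N) (M : ℕ) {p : (Fin N → ℝ) × ℝ}
    (h : ∀ i : Fin N, (i : ℕ) ≠ 0 → p.1 i = 0) :
    liftIneq hN M p = (axisVector hN M p.1, p.2) := if_pos h

theorem liftIneq_of_not_axis {N : ℕ} (hN : 0 < N) (M : ℕ) {p : (Fin N → ℝ) × ℝ}
    (h : ¬ ∀ i : Fin N, (i : ℕ) ≠ 0 → p.1 i = 0) :
    liftIneq hN M p =
      (prependFirst hN M p.1, p.2 + ((M : ℝ) - (N : ℝ)) * p.1 ⟨0, hN⟩) := if_neg h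

theorem axisVector_dotProduct {N : ℕ} (hN : 0 < N) {M : ℕ} (hM : 0 < M) (y : Fin N → ℝ)
    (x : Fin M → ℝ) : axisVector hN M y ⬝ᵥ x = y ⟨0, hN⟩ * x ⟨0, hM⟩ := by
  rw [dotProduct, Finset.sum_eq_single ⟨0, hM⟩]
  · simp [axisVector]
  · intro i _ hi
    have : (i : ℕ) ≠ 0 := fun h => hi (Fin.ext h)
    simp [axisVector, this]
  · simp

theorem dotProduct_eq_of_axis {N : ℕ} (hN : 0 < N) {y : Fin N → ℝ}
    (h : ∀ i : Fin N, (i : ℕ) ≠ 0 → y i = 0) (x : Fin N → ℝ) :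
    y ⬝ᵥ x = y ⟨0, hN⟩ * x ⟨0, hN⟩ := by
  rw [dotProduct, Finset.sum_eq_single ⟨0, hN⟩]
  · intro i _ hi
    rw [h i fun h => hi (Fin.ext h), zero_mul]
  · simp

/-- The list of subsets of the last `N` of `k + N` coordinates obtained from a list of subsets of
`Fin N`. -/
def shiftList {r N : ℕ} (k : ℕ) (S : Fin r → Finset (Fin N)) : Fin r → Finset (Fin (k + N)) :=
  fun i => (S i).map (Fin.natAddEmb k)

theorem shiftList_injective {r N : ℕ} (k : ℕ) {S : Fin r → Finset (Fin N)}
    (hS : Function.Injective S) : Function.Injective (shiftList k S) :=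
  (Finset.map_injective _).comp hS

theorem setPoint_shiftList_castAdd {r N : ℕ} {w : Fin r → ℝ} (hw : IsWeight w) (k : ℕ)
    (S : Fin r → Finset (Fin N)) (j : Fin k) :
    setPoint w (shiftList k S) (Fin.castAdd N j) = 1 := by
  rw [setPoint_eq_one_iff hw]
  intro i hi
  obtain ⟨l, -, hl⟩ := Finset.mem_map.1 hi
  have := congrArg Fin.val hl
  simp at this
  omega

theorem setPoint_shiftList_natAdd {r N : ℕ} {w : Fin r → ℝ} (hw : IsWeight w) (k : ℕ)
    (S : Fin r → Finset (Fin N)) (j : Fin N) :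
    setPoint w (shiftList k S) (Fin.natAdd k j) = setPoint w S j := by
  have h : ∀ i, Fin.natAdd k j ∈ shiftList k S i ↔ j ∈ S i := fun i => by
    simp [shiftList]
  simp only [setPoint_apply hw, h]

/-- Prepending copies of the largest entry does not lower the minimal cost of a list, since any set
using a new coordinate may be replaced by the empty set or by a singleton. -/
theorem exists_cost_le_cost_prependFirst {r N k : ℕ} {w : Fin r → ℝ} (hw : IsWeight w)
    (hr : r ≤ N + 1) (hN : 0 < N) {y : Fin N → ℝ} (hy : y ∈ chamber N)
    {T : Fin r → Finset (Fin (k + N))} (hT : Function.Injective T) :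
    ∃ S : Fin r → Finset (Fin N), Function.Injective S ∧
      cost w y S ≤ cost w (prependFirst hN (k + N) y) T := by
  classical
  set y' := prependFirst hN (k + N) y with hy'
  have hy'c : y' ∈ chamber (k + N) := prependFirst_mem_chamber hN _ hy
  set E : Finset (Finset (Fin (k + N))) :=
    insert ∅ (Finset.univ.image fun j : Fin N => {Fin.natAdd k j}) with hE
  have hEcard : r ≤ E.card := by
    rw [hE, Finset.card_insert_of_notMem (by simp), Finset.card_image_of_injective]
    · simpa using hr
    · intro a b h
      simpa using h
  obtain ⟨T', hT', hgood, hle⟩ := exists_injective_not_bad (fun i => (hw.pos i).le)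
    (fun A : Finset (Fin (k + N)) => ∑ j ∈ A, y' j)
    (fun A => ∃ j : Fin k, Fin.castAdd N j ∈ A) E hEcard
    (by
      rintro e he ⟨j, hj⟩
      rw [hE, Finset.mem_insert, Finset.mem_image] at he
      rcases he with rfl | ⟨l, -, rfl⟩
      · simp at hj
      · have := congrArg Fin.val (Finset.mem_singleton.1 hj)
        simp at this
        omega)
    (by
      rintro A ⟨j, hj⟩ e he
      rw [hE, Finset.mem_insert, Finset.mem_image] at he
      rcases he with rfl | ⟨l, -, rfl⟩
      · simpa using Finset.sum_nonneg fun i _ => hy'c.2 i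
      · rw [Finset.sum_singleton]
        refine le_trans (hy'c.1 (show Fin.castAdd N j ≤ Fin.natAdd k l from ?_))
          (Finset.single_le_sum (f := y') (fun i _ => hy'c.2 i) hj)
        rw [Fin.le_def, Fin.val_castAdd, Fin.val_natAdd]; omega) T hT
  have hpre : ∀ i, ((T' i).preimage (Fin.natAddEmb k) (Fin.natAddEmb k).injective.injOn).map
      (Fin.natAddEmb k) = T' i := by
    intro i
    rw [Finset.map_eq_image, Finset.image_preimage, Finset.filter_eq_self]
    intro l hl
    refine Fin.addCases (fun j hj => absurd ⟨j, hj⟩ (hgood i)) (fun j _ => ⟨j, rfl⟩) l hl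
  refine ⟨fun i => (T' i).preimage (Fin.natAddEmb k) (Fin.natAddEmb k).injective.injOn,
    fun a b h => hT' ?_, le_trans (le_of_eq ?_) hle⟩
  · rw [← hpre a, ← hpre b]; exact congrArg _ h
  · refine Finset.sum_congr rfl fun i _ => ?_
    conv_rhs => rw [← hpre i, Finset.sum_map]
    congr 1
    exact Finset.sum_congr rfl fun j _ => (prependFirst_natAdd hN k y j).symm

theorem le_two_pow_pred {r N : ℕ} (hr : 2 ≤ r) (hN : r - 1 ≤ N) (h21 : ¬ (r = 2 ∧ N = 1))
    (h32 : ¬ (r = 3 ∧ N = 2)) : r ≤ 2 ^ (N - 1) := by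
  rcases Nat.lt_or_ge N 3 with h | h
  · have h2 : N = 2 := by omega
    subst h2
    have : r = 2 := by omega
    subst this
    norm_num
  · obtain ⟨n, rfl⟩ := Nat.exists_eq_add_of_le h
    have h1 : n < 2 ^ n := Nat.lt_two_pow_self
    have h2 : 2 ^ (3 + n - 1) = 4 * 2 ^ n := by
      rw [show 3 + n - 1 = n + 2 by omega, pow_add]; ring
    omega

/-- When a facet of the cube has at least `r` vertices, the lineup polytope reaches that facet. -/
theorem exists_setPoint_eq_one {r d : ℕ} {w : Fin r → ℝ} (hw : IsWeight w) (o : Fin d)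
    (hr : r ≤ 2 ^ (d - 1)) :
    ∃ S : Fin r → Finset (Fin d), Function.Injective S ∧ setPoint w S o = 1 := by
  obtain ⟨f⟩ : Nonempty (Fin r ↪ (Finset.univ.erase o).powerset) := by
    refine Function.Embedding.nonempty_of_card_le ?_
    rw [Fintype.card_coe, Finset.card_powerset, Finset.card_erase_of_mem (Finset.mem_univ o),
      Finset.card_univ, Fintype.card_fin, Fintype.card_fin]
    exact hr
  refine ⟨fun i => f i, Subtype.val_injective.comp f.injective, ?_⟩
  rw [setPoint_eq_one_iff hw]
  intro i hi
  exact Finset.notMem_erase o _ (Finset.mem_powerset.1 (f i).2 hi)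

/-- The lifted inequalities are valid. -/
theorem IsHRep.liftIneq_dotProduct_le {r N k : ℕ} {w : Fin r → ℝ} (hw : IsWeight w)
    (hN : 0 < N) (hr : r ≤ N + 1) (hr2 : r ≤ 2 ^ (N - 1)) {I : Set ((Fin N → ℝ) × ℝ)}
    (hI : IsHRep (lineupPolytope w (cube N)) I) {p : (Fin N → ℝ) × ℝ} (hp : p ∈ I)
    {x : Fin (k + N) → ℝ} (hx : x ∈ lineupPolytope w (cube (k + N))) :
    (liftIneq hN (k + N) p).1 ⬝ᵥ x ≤ (liftIneq hN (k + N) p).2 := by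
  have hpc := hI.2.1 p hp
  by_cases hax : ∀ i : Fin N, (i : ℕ) ≠ 0 → p.1 i = 0
  · rw [liftIneq_of_axis hN _ hax, axisVector_dotProduct hN (by omega)]
    obtain ⟨S, hS, hS1⟩ := exists_setPoint_eq_one hw ⟨0, hN⟩ hr2
    have h1 := hI.dotProduct_le hp (setPoint_mem w hS)
    rw [dotProduct_eq_of_axis hN hax, hS1] at h1
    exact (mul_le_mul_of_nonneg_left (le_one_of_mem_lineupPolytope hw hx _) (hpc.2 _)).trans h1
  · rw [liftIneq_of_not_axis hN _ hax]
    refine dotProduct_le_of_mem (fun T hT => ?_) hx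
    obtain ⟨S, hS, hle⟩ := exists_cost_le_cost_prependFirst hw hr hN hpc hT
    have h1 := hI.dotProduct_le hp (setPoint_mem w hS)
    rw [dotProduct_setPoint hw] at h1 ⊢
    rw [Fin.sum_univ_add]
    simp only [prependFirst_castAdd, prependFirst_natAdd, Finset.sum_const, Finset.card_univ,
      Fintype.card_fin, nsmul_eq_mul, Nat.cast_add]
    linarith

/-- A sorted point satisfying the lifted inequalities lies in the larger lineup polytope. -/
theorem IsHRep.mem_of_liftIneq {r N k : ℕ} {w : Fin r → ℝ} (hw : IsWeight w)
    (hN : 0 < N) (hr2 : r ≤ 2 ^ (N - 1)) {I : Set ((Fin N → ℝ) × ℝ)}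
    (hI : IsHRep (lineupPolytope w (cube N)) I) {x : Fin (k + N) → ℝ}
    (hxc : x ∈ chamber (k + N))
    (hx : ∀ p ∈ I, (liftIneq hN (k + N) p).1 ⬝ᵥ x ≤ (liftIneq hN (k + N) p).2) :
    x ∈ lineupPolytope w (cube (k + N)) := by
  by_contra hnot
  obtain ⟨z, hzc, hz⟩ := exists_chamber_separating w hxc hnot
  set o : Fin N := ⟨0, hN⟩ with ho
  have hM : 0 < k + N := by omega
  have hx0 : x ⟨0, hM⟩ ≤ 1 := by
    obtain ⟨p, hp, hax, hpos, hle⟩ := hI.exists_axis hw hN hr2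
    have h1 := hx p hp
    rw [liftIneq_of_axis hN _ hax, axisVector_dotProduct hN hM] at h1
    by_contra! h
    have := mul_lt_mul_of_pos_left h hpos
    linarith
  have hx1 : ∀ j, x j ≤ 1 := fun j =>
    (hxc.1 (show (⟨0, hM⟩ : Fin (k + N)) ≤ j from Nat.zero_le _)).trans hx0
  -- the first `k` coordinates are cut off and their deficits are charged to the next one
  set δ : ℝ := ∑ j : Fin k, (1 - x (Fin.castAdd N j)) with hδ
  have hδ0 : 0 ≤ δ := Finset.sum_nonneg fun j _ => sub_nonneg.2 (hx1 _)
  set x' : Fin N → ℝ := fun j => x (Fin.natAdd k j) - if j = o then δ else 0 with hx'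
  have hdot : ∀ y : Fin N → ℝ, y ⬝ᵥ x' = ∑ j, y j * x (Fin.natAdd k j) - y o * δ := by
    intro y
    simp [hx', dotProduct, mul_sub, Finset.sum_sub_distrib]
  have hx'1 : ∀ j, x' j ≤ x (Fin.natAdd k j) := by
    intro j; simp only [hx']; split_ifs <;> linarith
  have hx'I : ∀ p ∈ I, p.1 ⬝ᵥ x' ≤ p.2 := by
    intro p hp
    have h1 := hx p hp
    have hpc := hI.2.1 p hp
    by_cases hax : ∀ i : Fin N, (i : ℕ) ≠ 0 → p.1 i = 0
    · rw [liftIneq_of_axis hN _ hax, axisVector_dotProduct hN hM] at h1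
      rw [dotProduct_eq_of_axis hN hax]
      refine (mul_le_mul_of_nonneg_left ((hx'1 _).trans ?_) (hpc.2 _)).trans h1
      exact hxc.1 (Nat.zero_le _)
    · rw [liftIneq_of_not_axis hN _ hax] at h1
      rw [hdot]
      have h2 : prependFirst hN (k + N) p.1 ⬝ᵥ x = p.1 o * (∑ j : Fin k, x (Fin.castAdd N j)) +
          ∑ j, p.1 j * x (Fin.natAdd k j) := by
        rw [dotProduct, Fin.sum_univ_add]
        simp only [prependFirst_castAdd, prependFirst_natAdd, Finset.mul_sum, ho]
      have h3 : δ = k - ∑ j : Fin k, x (Fin.castAdd N j) := by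
        simp [hδ, Finset.sum_sub_distrib]
      simp only [h2, Nat.cast_add, ← ho] at h1
      rw [h3]
      linarith
  obtain ⟨S, hS, hle⟩ := hI.exists_dotProduct_le hw
    (hr2.trans (Nat.pow_le_pow_right two_pos (Nat.sub_le N 1)))
    (fun j => (hx'1 j).trans (hx1 _)) hx'I (z := fun j => z (Fin.natAdd k j))
    ⟨fun i j hij => hzc.1 (by rw [Fin.le_def] at hij ⊢; simpa using hij), fun j => hzc.2 _⟩
  refine (hz _ (shiftList_injective k hS)).not_ge ?_
  rw [hdot] at hle
  rw [dotProduct, dotProduct, Fin.sum_univ_add, Fin.sum_univ_add]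
  simp only [setPoint_shiftList_castAdd hw, setPoint_shiftList_natAdd hw, mul_one]
  have h1 : ∑ j : Fin k, z (Fin.castAdd N j) * x (Fin.castAdd N j) + z (Fin.natAdd k o) * δ ≤
      ∑ j : Fin k, z (Fin.castAdd N j) := by
    rw [hδ, Finset.mul_sum, ← Finset.sum_add_distrib]
    refine Finset.sum_le_sum fun j _ => ?_
    have h2 : z (Fin.natAdd k o) ≤ z (Fin.castAdd N j) := hzc.1 (by
      rw [Fin.le_def, Fin.val_castAdd, Fin.val_natAdd]; omega)
    have := mul_nonneg (sub_nonneg.2 h2) (sub_nonneg.2 (hx1 (Fin.castAdd N j)))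
    linarith
  simp only [dotProduct] at hle
  linarith

end LineupCube

theorem mainTheorem1 (r N M : ℕ) (hr : 2 ≤ r) (hN : r - 1 ≤ N)
    (h21 : ¬ (r = 2 ∧ N = 1)) (h32 : ¬ (r = 3 ∧ N = 2)) (hM : N < M)
    (w : Fin r → ℝ) (hw : LineupCube.IsWeight w)
    (I : Set ((Fin N → ℝ) × ℝ))
    (hI : LineupCube.IsHRep (LineupCube.lineupPolytope w (LineupCube.cube N)) I) :
    LineupCube.IsHRep (LineupCube.lineupPolytope w (LineupCube.cube M))
      (LineupCube.liftIneq (show 0 < N by omega) M '' I) := by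
  have hr2 := LineupCube.le_two_pow_pred hr hN h21 h32
  obtain ⟨k, rfl⟩ := Nat.exists_eq_add_of_le' hM.le
  refine ⟨hI.1.image _, ?_, ?_⟩
  · rintro _ ⟨p, hp, rfl⟩
    have hpc := hI.2.1 p hp
    by_cases hax : ∀ i : Fin N, (i : ℕ) ≠ 0 → p.1 i = 0
    · rw [LineupCube.liftIneq_of_axis _ _ hax]
      exact LineupCube.axisVector_mem_chamber _ _ hpc
    · rw [LineupCube.liftIneq_of_not_axis _ _ hax]
      exact LineupCube.prependFirst_mem_chamber _ _ hpc
  · ext x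
    rw [Set.mem_ofPred_eq, Set.forall_mem_image, ← LineupCube.absDown_mem_lineupPolytope_iff]
    exact ⟨fun h p hp => hI.liftIneq_dotProduct_le hw _ (by omega) hr2 hp h,
      fun h => hI.mem_of_liftIneq hw _ hr2 (LineupCube.absDown_mem_chamber x)
        fun p hp => h hp⟩
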